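/- Let $G=(V,E)$ be a finite multigraph (loops and parallel edges allowed). Let $\mathcal H_G$ be the hypergraph with vertex set $V\cup\{w_e : e\in E\}$, where the $w_e$ are $|E|$ distinct new vertices, and edge set $\{\{u_e,v_e,w_e\} : e\in E\}$, where $u_e,v_e$ are the two ends of $e$ in $G$ (possibly equal). Let $P(\mathcal H_G,\lambda)$ be its chromatic polynomial, that is, the polynomial in $\lambda$ whose value at every integer $\lambda\ge 1$ is the number of weak proper $\lambda$-colourings of $\mathcal H_G$, i.e. of maps from the vertex set of $\mathcal H_G$ to $\{1,\dots,\lambda\}$ under which every edge of $\mathcal H_G$ receives more than one colour. Let $$T_G(x,y)=\sum_{A\subseteq E}(x-1)^{r(E)-r(A)}(y-1)^{|A|-r(A)}$$ be the Tutte polynomial of $G$, where $r(A)=|V|-c(A)$ and $c(A)$ is the number of components of the spanning subgraph $(V,A)$. Then $$|P(\mathcal H_G,-1)|=T_G(0,2),$$ and this number is equal to the number of totally cyclic orientations of $G$. Here an orientation chooses one of two directions for every edge, a loop also having two directions (so that $G$ has $2^{|E|}$ orientations), and it is totally cyclic if each arc is contained in some directed cycle; an oriented loop is itself a directed cycle.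 -/

import Mathlib

namespace Hypergraph

variable {γ : Type*}

/-- A weak proper `n`-colouring of a hypergraph: a map from the vertices to a set of `n` colours
such that every edge receives more than one colour. -/
def IsWeakProper (H : Hypergraph γ) {n : ℕ} (φ : H.vertexSet → Fin n) : Prop :=
  ∀ e ∈ H.edgeSet, (φ '' {v | (v : γ) ∈ e}).Nontrivial

/-- The number of weak proper `n`-colourings. -/
noncomputable def numWeakColourings (H : Hypergraph γ) (n : ℕ) : ℕ :=
  Nat.card {φ : H.vertexSet → Fin n // H.IsWeakProper φ}

/-- `P` counts the weak proper `n`-colourings of `H`, for every integer `n ≥ 1`. -/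
def CountsColourings (H : Hypergraph γ) (P : Polynomial ℤ) : Prop :=
  ∀ n : ℕ, 1 ≤ n → P.eval (n : ℤ) = H.numWeakColourings n

open Classical in
/-- The chromatic polynomial of `H`: the polynomial whose value at every integer `n ≥ 1` is the
number of weak proper `n`-colourings of `H`. For a finite vertex set it exists and is unique, see
`existsUnique_countsColourings`. -/
noncomputable def chromaticPolynomial (H : Hypergraph γ) : Polynomial ℤ :=
  if h : ∃ P : Polynomial ℤ, H.CountsColourings P then h.choose else 0

theorem countsColourings_unique (H : Hypergraph γ) {P Q : Polynomial ℤ}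
    (hP : H.CountsColourings P) (hQ : H.CountsColourings Q) : P = Q := by
  refine Polynomial.eq_of_infinite_eval_eq P Q ?_
  refine Set.Infinite.mono (s := (fun n : ℕ => (n : ℤ)) '' Set.Ici 1) ?_
    ((Set.Ici_infinite 1).image (Nat.cast_injective.injOn))
  rintro _ ⟨n, hn, rfl⟩
  exact (hP n hn).trans (hQ n hn).symm

/-- Functions with a given kernel are injections of the quotient. -/
def kerEquiv {X Y : Type*} (r : Setoid X) : {φ : X → Y // Setoid.ker φ = r} ≃ (Quotient r ↪ Y) where
  toFun φ := ⟨Quotient.lift φ.1 (fun a b hab => by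
      have : Setoid.ker φ.1 a b := by rw [φ.2]; exact hab
      exact this), by
    rintro ⟨a⟩ ⟨b⟩ hab
    refine Quotient.sound ?_
    have : Setoid.ker φ.1 a b := hab
    rw [φ.2] at this
    exact this⟩
  invFun f := ⟨fun x => f ⟦x⟧, by
    ext a b
    simp only [Setoid.ker_def, f.injective.eq_iff]
    exact Quotient.eq⟩
  left_inv φ := rfl
  right_inv f := by
    ext ⟨a⟩
    rfl

theorem exists_countsColourings (H : Hypergraph γ) (hV : H.vertexSet.Finite) :
    ∃ P : Polynomial ℤ, H.CountsColourings P := by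
  classical
  have : Finite H.vertexSet := hV
  have : Fintype H.vertexSet := Fintype.ofFinite _
  have hfs : Finite (Setoid H.vertexSet) :=
    Finite.of_injective (fun r : Setoid H.vertexSet => fun a b => r a b) (fun r s h => by
      ext a b
      exact iff_of_eq (congrFun (congrFun h a) b))
  have : Fintype (Setoid H.vertexSet) := Fintype.ofFinite _
  let good : Setoid H.vertexSet → Prop := fun r =>
    ∀ e ∈ H.edgeSet, ∃ u v : H.vertexSet, (u : γ) ∈ e ∧ (v : γ) ∈ e ∧ ¬ r u v
  have hgood : ∀ {n : ℕ} (φ : H.vertexSet → Fin n), H.IsWeakProper φ ↔ good (Setoid.ker φ) := by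
    intro n φ
    refine forall₂_congr fun e _ => ⟨?_, ?_⟩
    · rintro ⟨_, ⟨u, hu, rfl⟩, _, ⟨v, hv, rfl⟩, huv⟩
      exact ⟨u, v, hu, hv, huv⟩
    · rintro ⟨u, v, hu, hv, huv⟩
      exact ⟨_, ⟨u, hu, rfl⟩, _, ⟨v, hv, rfl⟩, huv⟩
  refine ⟨∑ r : {r : Setoid H.vertexSet // good r}, descPochhammer ℤ (Nat.card (Quotient r.1)), ?_⟩
  intro n _
  let E : {φ : H.vertexSet → Fin n // H.IsWeakProper φ} ≃
      Σ r : {r : Setoid H.vertexSet // good r}, (Quotient r.1 ↪ Fin n) :=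
    { toFun := fun φ => ⟨⟨Setoid.ker φ.1, (hgood φ.1).1 φ.2⟩, kerEquiv _ ⟨φ.1, rfl⟩⟩
      invFun := fun p => ⟨((kerEquiv p.1.1).symm p.2).1, by
        rw [hgood, ((kerEquiv p.1.1).symm p.2).2]; exact p.1.2⟩
      left_inv := fun φ => rfl
      right_inv := by
        rintro ⟨⟨r, hr⟩, f⟩
        obtain ⟨⟨φ, rfl⟩, rfl⟩ := (kerEquiv r).surjective f
        rfl }
  rw [numWeakColourings, Nat.card_congr E, Nat.card_sigma, Polynomial.eval_finsetSum]
  push_cast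
  refine Finset.sum_congr rfl fun r _ => ?_
  have : Fintype (Quotient r.1) := Fintype.ofFinite _
  rw [descPochhammer_eval_eq_descFactorial, Nat.card_eq_fintype_card,
    Nat.card_eq_fintype_card, Fintype.card_embedding_eq, Fintype.card_fin]

theorem existsUnique_countsColourings (H : Hypergraph γ) (hV : H.vertexSet.Finite) :
    ∃! P : Polynomial ℤ, H.CountsColourings P := by
  obtain ⟨P, hP⟩ := H.exists_countsColourings hV
  exact ⟨P, hP, fun Q hQ => H.countsColourings_unique hQ hP⟩

theorem chromaticPolynomial_countsColourings (H : Hypergraph γ) (hV : H.vertexSet.Finite) :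
    H.CountsColourings H.chromaticPolynomial := by
  have h := H.exists_countsColourings hV
  rw [chromaticPolynomial, dif_pos h]
  exact h.choose_spec

end Hypergraph

namespace Graph

variable {α β : Type*}

/-- The hypergraph obtained from the multigraph `G` by adding one new vertex `w_e` (here `inr e`)
for every edge `e`, and turning each edge `e` with ends `u`, `v` into the edge `{u, v, w_e}`. -/
def edgeHypergraph (G : Graph α β) : Hypergraph (α ⊕ β) where
  vertexSet := Sum.inl '' G.vertexSet ∪ Sum.inr '' G.edgeSet
  edgeSet := {s | ∃ e u v, G.IsLink e u v ∧ s = {Sum.inl u, Sum.inl v, Sum.inr e}}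
  subset_vertexSet_of_mem_edgeSet' := by
    rintro _ ⟨e, u, v, h, rfl⟩ x (rfl | rfl | rfl)
    · exact Or.inl ⟨u, h.left_mem, rfl⟩
    · exact Or.inl ⟨v, h.right_mem, rfl⟩
    · exact Or.inr ⟨e, h.edge_mem, rfl⟩

/-- The number of connected components of `G`: the number of classes of the equivalence relation
on the vertices generated by adjacency. -/
noncomputable def numComponents (G : Graph α β) : ℕ :=
  Nat.card (Quot fun x y : G.vertexSet => G.Adj x y)

/-- The rank `r(A) = |V| - c(A)`, where `c(A)` is the number of components of the spanning subgraph
`(V, A)`. The subtraction does not truncate, since `c(A) ≤ |V|`. -/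
noncomputable def edgeRank (G : Graph α β) (A : Set β) : ℕ :=
  G.vertexSet.ncard - (G.restrict A).numComponents

/-- The value at `(x, y)` of the Tutte polynomial of a finite multigraph,
`∑_{A ⊆ E} (x - 1)^(r(E) - r(A)) (y - 1)^(|A| - r(A))`.
The subtractions in the exponents do not truncate, since `r(A) ≤ r(E)` and `r(A) ≤ |A|`. -/
noncomputable def tuttePolynomial {R : Type*} [CommRing R] (G : Graph α β) (x y : R) : R :=
  ∑ᶠ (A : Set β) (_ : A ⊆ G.edgeSet),
    (x - 1) ^ (G.edgeRank G.edgeSet - G.edgeRank A) * (y - 1) ^ (A.ncard - G.edgeRank A)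

/-- A fixed reference listing of the two ends of an edge: the first end. -/
noncomputable def firstEnd (G : Graph α β) (e : G.edgeSet) : α :=
  (G.exists_isLink_of_mem_edgeSet e.2).choose

/-- A fixed reference listing of the two ends of an edge: the second end. -/
noncomputable def secondEnd (G : Graph α β) (e : G.edgeSet) : α :=
  (G.exists_isLink_of_mem_edgeSet e.2).choose_spec.choose

theorem isLink_firstEnd_secondEnd (G : Graph α β) (e : G.edgeSet) :
    G.IsLink e (G.firstEnd e) (G.secondEnd e) :=
  (G.exists_isLink_of_mem_edgeSet e.2).choose_spec.choose_spec

/-- An orientation of `G`: for every edge (a loop included) one of its two directions, `true` being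
the direction from the first to the second end in the reference listing. So a multigraph with `m`
edges has `2 ^ m` orientations. -/
abbrev Orientation (G : Graph α β) : Type _ := G.edgeSet → Bool

namespace Orientation

variable {G : Graph α β}

/-- The tail of the arc that the orientation makes of the edge `e`. -/
noncomputable def tail (σ : G.Orientation) (e : G.edgeSet) : α :=
  if σ e = true then G.firstEnd e else G.secondEnd e

/-- The head of the arc that the orientation makes of the edge `e`. -/
noncomputable def head (σ : G.Orientation) (e : G.edgeSet) : α :=
  if σ e = true then G.secondEnd e else G.firstEnd e

/-- The arcs `c 0, …, c k` form a directed cycle (of length `k + 1`): the head of each is the tail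
of the next one, cyclically (addition in `Fin (k + 1)` wraps around), and the `k + 1` vertices
passed through are distinct. -/
def IsDirectedCycle (σ : G.Orientation) {k : ℕ} (c : Fin (k + 1) → G.edgeSet) : Prop :=
  (∀ i, σ.head (c i) = σ.tail (c (i + 1))) ∧ Function.Injective fun i => σ.tail (c i)

/-- An orientation is totally cyclic if each arc is contained in some directed cycle. -/
def IsTotallyCyclic (σ : G.Orientation) : Prop :=
  ∀ e : G.edgeSet, ∃ (k : ℕ) (c : Fin (k + 1) → G.edgeSet), σ.IsDirectedCycle c ∧ ∃ i, c i = e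

end Orientation

end Graph

/-! ### Relations all of whose forward closed sets are backward closed -/

/-! Up to sign, all three numbers are the sum of (-1)^c(A) over all edge sets A. For the Tutte
polynomial at (0, 2) this is immediate, as r(E) - r(A) = c(A) - c(E). For the chromatic polynomial,
fix the colours of V: the vertex w_e then has n - 1 choices if the ends of e agree and n otherwise.
Expanding the product of these factors gives the sum of (-1)^|A| n^(|E| - |A| + c(A)), to be
evaluated at n = -1.

The orientations carry the real work (`sum_isBalanced_addOriented`). An orientation is totally
cyclic iff its arc relation is balanced, a condition that makes sense for any relation. Contracting
an edge can thus be modelled by adding both its arcs, with the vertex set unchanged. Fix an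
orientation R of the other edges and let e = uv. If e is not a bridge, the number of balanced
relations among R + uv and R + vu equals that among R and R + uv + vu. If e is a bridge, neither R +
uv nor R + vu is balanced, while R and R + uv + vu are balanced together. Since c drops by one
exactly for bridges, induction on the edges gives the signed sum. The absolute value is then
resolved because a count is nonnegative. -/

/-- Every set closed under `R` in the forward direction is closed in the backward direction. For a
finite digraph this says that every arc lies on a directed cycle. -/
def Relation.IsBalanced {V : Type*} (R : V → V → Prop) : Prop :=
  ∀ S : Set V, (∀ x y, R x y → x ∈ S → y ∈ S) → ∀ x y, R x y → y ∈ S → x ∈ S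

/-- The relation `R` with one more arc from `a` to `b`. -/
def Relation.addArc {V : Type*} (R : V → V → Prop) (a b : V) (x y : V) : Prop :=
  R x y ∨ x = a ∧ y = b

namespace Relation

variable {V : Type*} {R : V → V → Prop} {u v : V}

theorem mem_iff_of_eqvGen {S : Set V} (h₁ : ∀ x y, R x y → x ∈ S → y ∈ S)
    (h₂ : ∀ x y, R x y → y ∈ S → x ∈ S) {a b : V} (h : EqvGen R a b) : a ∈ S ↔ b ∈ S := by
  induction h with
  | rel x y h => exact ⟨h₁ x y h, h₂ x y h⟩
  | refl x => rfl
  | symm x y _ ih => exact ih.symm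
  | trans x y z _ _ ih₁ ih₂ => exact ih₁.trans ih₂

theorem isBalanced_of_symmetric (h : ∀ x y, R x y → R y x) : IsBalanced R :=
  fun _ hS x y hxy hy => hS y x (h x y hxy) hy

/-- A forward closed set is closed in both directions under `R`, hence a union of components, and so
cannot separate `u` from `v`. -/
theorem IsBalanced.addArc_of_eqvGen (h : IsBalanced R) (huv : EqvGen R u v) :
    IsBalanced (addArc R u v) := by
  intro S hS x y hxy hy
  have h₁ : ∀ x y, R x y → x ∈ S → y ∈ S := fun x y h => hS x y (Or.inl h)
  rcases hxy with hxy | ⟨rfl, rfl⟩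
  · exact h S h₁ x y hxy hy
  · exact (mem_iff_of_eqvGen h₁ (h S h₁) huv).2 hy

theorem IsBalanced.addArc_symm (h : IsBalanced (addArc R u v)) :
    IsBalanced (addArc (addArc R u v) v u) := by
  intro S hS x y hxy hy
  rcases hxy with hxy | ⟨rfl, rfl⟩
  · exact h S (fun x y h => hS x y (Or.inl h)) x y hxy hy
  · exact hS y x (Or.inl (Or.inr ⟨rfl, rfl⟩)) hy

theorem addArc_comm (a b c d : V) : addArc (addArc R a b) c d = addArc (addArc R c d) a b := by
  ext x y
  simp only [addArc]
  tauto

/-- Any set respects at least one of the two arcs, so the hypothesis for that arc applies to it. -/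
theorem IsBalanced.of_addArc_of_addArc (h₁ : IsBalanced (addArc R u v))
    (h₂ : IsBalanced (addArc R v u)) : IsBalanced R := by
  intro S hS x y hxy hy
  by_cases h : u ∈ S → v ∈ S
  · refine h₁ S ?_ x y (Or.inl hxy) hy
    rintro a b (hab | ⟨rfl, rfl⟩)
    exacts [hS a b hab, h]
  · refine h₂ S ?_ x y (Or.inl hxy) hy
    rintro a b (hab | ⟨rfl, rfl⟩)
    exacts [hS a b hab, fun _ => by tauto]

/-- A forward closed set witnessing that adding one direction of an edge does not give a balanced
relation, although adding both directions does. -/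
theorem exists_of_not_isBalanced_addArc (h : IsBalanced (addArc (addArc R u v) v u))
    (hn : ¬ IsBalanced (addArc R u v)) :
    ∃ S : Set V, (∀ x y, R x y → x ∈ S → y ∈ S) ∧ u ∉ S ∧ v ∈ S := by
  unfold IsBalanced at hn
  push Not at hn
  obtain ⟨S, hS, x, y, hxy, hy, hx⟩ := hn
  refine ⟨S, fun x y h => hS x y (Or.inl h), ?_⟩
  by_contra hc
  refine hx (h S ?_ x y (Or.inl hxy) hy)
  rintro a b (hab | ⟨rfl, rfl⟩) ha
  · exact hS a b hab ha
  · by_contra hb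
    exact hc ⟨hb, ha⟩

/-- Uncrossing: if both fail, there are forward closed `S` and `T` with `v` only in `S` and `u` only
in `T`. Their intersection misses both ends and their union contains both, so both sets respect the
two new arcs and are backward closed. This forces `S` to be backward closed too, a union of
components separating `u` from `v`. -/
theorem isBalanced_addArc_or (huv : EqvGen R u v)
    (h : IsBalanced (addArc (addArc R u v) v u)) :
    IsBalanced (addArc R u v) ∨ IsBalanced (addArc R v u) := by
  by_contra hn
  rw [not_or] at hn
  obtain ⟨S, hS, huS, hvS⟩ := exists_of_not_isBalanced_addArc h hn.1
  obtain ⟨T, hT, hvT, huT⟩ := exists_of_not_isBalanced_addArc (by rwa [addArc_comm]) hn.2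
  have hI : ∀ x y, R x y → y ∈ S ∩ T → x ∈ S ∩ T := fun x y hxy =>
    h (S ∩ T) (by
      rintro a b ((hab | ⟨rfl, rfl⟩) | ⟨rfl, rfl⟩) ⟨ha, ha'⟩
      exacts [⟨hS a b hab ha, hT a b hab ha'⟩, absurd ha huS, absurd ha' hvT])
      x y (Or.inl (Or.inl hxy))
  have hU : ∀ x y, R x y → y ∈ S ∪ T → x ∈ S ∪ T := fun x y hxy =>
    h (S ∪ T) (by
      rintro a b ((hab | ⟨rfl, rfl⟩) | ⟨rfl, rfl⟩) hab'
      exacts [hab'.imp (hS a b hab) (hT a b hab), Or.inl hvS, Or.inr huT])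
      x y (Or.inl (Or.inl hxy))
  refine huS ((mem_iff_of_eqvGen hS ?_ huv).2 hvS)
  intro x y hxy hy
  rcases hU x y hxy (Or.inl hy) with hx | hx
  · exact hx
  · exact (hI x y hxy ⟨hy, hT x y hxy hx⟩).1

/-- The component of `v` is forward closed, as the new arc only enters it, but it does not contain
`u`. -/
theorem not_isBalanced_addArc (huv : ¬ EqvGen R u v) : ¬ IsBalanced (addArc R u v) := by
  intro h
  refine huv (.symm _ _ (h {x | EqvGen R v x} ?_ u v (Or.inr ⟨rfl, rfl⟩) (.refl v)))
  rintro x y (hxy | ⟨rfl, rfl⟩) hx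
  · exact .trans _ _ _ hx (.rel _ _ hxy)
  · exact .refl _

theorem IsBalanced.of_addArc_symm (huv : ¬ EqvGen R u v)
    (h : IsBalanced (addArc (addArc R u v) v u)) : IsBalanced R := by
  intro S hS x y hxy hy
  have key : ∀ C : Set V, (∀ a b, R a b → (a ∈ C ↔ b ∈ C)) → (u ∈ C ↔ v ∉ C) → y ∈ C → x ∈ S := by
    intro C hC huC hyC
    -- `C` is a union of components containing exactly one of `u`, `v`. Keep `S` inside `C`, and
    -- outside take everything or nothing according to whether the end lying in `C` belongs to `S`.
    -- The resulting set respects both arcs of the bridge and agrees with `S` on `C`.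
    have := h {z | (z ∈ C ∧ z ∈ S) ∨ (z ∉ C ∧ ∃ w ∈ S, w ∈ C ∧ (w = u ∨ w = v))} (by
      rintro a b ((hab | ⟨rfl, rfl⟩) | ⟨rfl, rfl⟩)
      · exact Or.imp (And.imp (hC a b hab).1 (hS a b hab)) (And.imp_left (mt (hC a b hab).2))
      · simp only [Set.mem_ofPred_eq]
        by_cases ha : a ∈ C
        · have hb := huC.1 ha
          rintro (h' | h')
          · exact Or.inr ⟨hb, a, h'.2, ha, Or.inl rfl⟩
          · exact absurd ha h'.1
        · have hb : b ∈ C := by tauto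
          rintro (h' | ⟨-, w, hw, hwC, rfl | rfl⟩)
          · exact absurd h'.1 ha
          · exact absurd hwC ha
          · exact Or.inl ⟨hb, hw⟩
      · simp only [Set.mem_ofPred_eq]
        by_cases ha : a ∈ C
        · have hb : b ∉ C := by tauto
          rintro (h' | h')
          · exact Or.inr ⟨hb, a, h'.2, ha, Or.inr rfl⟩
          · exact absurd ha h'.1
        · have hb : b ∈ C := by tauto
          rintro (h' | ⟨-, w, hw, hwC, rfl | rfl⟩)
          · exact absurd h'.1 ha
          · exact Or.inl ⟨hb, hw⟩
          · exact absurd hwC ha) x y (Or.inl (Or.inl hxy)) (Or.inl ⟨hyC, hy⟩)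
    have hxC := (hC x y hxy).2 hyC
    rcases this with h' | h'
    · exact h'.2
    · exact absurd hxC h'.1
  have hC : ∀ a b, R a b → (EqvGen R u a ↔ EqvGen R u b) := fun a b hab =>
    ⟨fun h => .trans _ _ _ h (.rel _ _ hab), fun h => .trans _ _ _ h (.symm _ _ (.rel _ _ hab))⟩
  by_cases hy' : EqvGen R u y
  · exact key {z | EqvGen R u z} hC (iff_of_true (.refl u) huv) hy'
  · exact key {z | ¬ EqvGen R u z} (fun a b hab => not_congr (hC a b hab))
      (iff_of_false (not_not_intro (.refl u)) (not_not_intro huv)) hy'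

theorem IsBalanced.addArc_addArc (h : IsBalanced R) :
    IsBalanced (addArc (addArc R u v) v u) := by
  intro S hS x y hxy hy
  rcases hxy with (hxy | ⟨rfl, rfl⟩) | ⟨rfl, rfl⟩
  · exact h S (fun a b hab => hS a b (Or.inl (Or.inl hab))) x y hxy hy
  · exact hS _ _ (Or.inr ⟨rfl, rfl⟩) hy
  · exact hS _ _ (Or.inl (Or.inr ⟨rfl, rfl⟩)) hy

open Classical in
/-- Deletion and contraction of an edge that is not a bridge. -/
theorem isBalanced_addArc_add_of_eqvGen (huv : EqvGen R u v) :
    (if IsBalanced (addArc R v u) then 1 else 0) + (if IsBalanced (addArc R u v) then 1 else 0) =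
      (if IsBalanced R then 1 else 0) +
        (if IsBalanced (addArc (addArc R u v) v u) then (1 : ℤ) else 0) := by
  have h₁ : IsBalanced R → IsBalanced (addArc R u v) := fun h => h.addArc_of_eqvGen huv
  have h₂ : IsBalanced R → IsBalanced (addArc R v u) := fun h => h.addArc_of_eqvGen (.symm _ _ huv)
  have h₃ : IsBalanced (addArc R u v) → IsBalanced (addArc (addArc R u v) v u) :=
    fun h => h.addArc_symm
  have h₄ : IsBalanced (addArc R v u) → IsBalanced (addArc (addArc R u v) v u) :=
    fun h => by rw [addArc_comm]; exact h.addArc_symm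
  have h₅ := isBalanced_addArc_or huv
  have h₆ := IsBalanced.of_addArc_of_addArc (R := R) (u := u) (v := v)
  -- Inclusion-exclusion: `R` is balanced iff both one-arc relations are, and the two-arc relation
  -- iff at least one of them is.
  split_ifs <;> first | rfl | (exfalso; tauto)

open Classical in
/-- Deletion and contraction of a bridge. -/
theorem isBalanced_addArc_add_of_not_eqvGen (huv : ¬ EqvGen R u v) :
    (if IsBalanced (addArc R v u) then 1 else 0) + (if IsBalanced (addArc R u v) then 1 else 0) =
      -(if IsBalanced R then 1 else 0) +
        (if IsBalanced (addArc (addArc R u v) v u) then (1 : ℤ) else 0) := by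
  have h₁ := not_isBalanced_addArc huv
  have h₂ := not_isBalanced_addArc (R := R) (u := v) (v := u) fun h => huv (.symm _ _ h)
  have h₃ : IsBalanced (addArc (addArc R u v) v u) ↔ IsBalanced R :=
    ⟨.of_addArc_symm huv, .addArc_addArc⟩
  simp [h₁, h₂, h₃]

/-! ### Components after adding an edge -/

/-- Adding an edge between two vertices of the same component keeps the components. -/
theorem card_quot_addArc_of_eqvGen (huv : EqvGen R u v) :
    Nat.card (Quot (addArc (addArc R u v) v u)) = Nat.card (Quot R) := by
  have h : Quot.mk R u = Quot.mk R v := Quot.eqvGen_sound huv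
  refine Nat.card_congr
    { toFun := Quot.lift (Quot.mk R) ?_
      invFun := Quot.lift (Quot.mk _) fun a b hab => Quot.sound (Or.inl (Or.inl hab))
      left_inv := by rintro ⟨x⟩; rfl
      right_inv := by rintro ⟨x⟩; rfl }
  rintro a b ((hab | ⟨rfl, rfl⟩) | ⟨rfl, rfl⟩)
  exacts [Quot.sound hab, h, h.symm]

open Classical in
/-- Adding an edge between two components joins them. -/
theorem card_quot_addArc_of_not_eqvGen [Finite V] (huv : ¬ EqvGen R u v) :
    Nat.card (Quot (addArc (addArc R u v) v u)) + 1 = Nat.card (Quot R) := by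
  have h : Quot.mk R u ≠ Quot.mk R v := fun h => huv (Quot.eqvGen_exact h)
  let R' := addArc (addArc R u v) v u
  have hR : ∀ a b, R a b → R' a b := fun a b hab => Or.inl (Or.inl hab)
  have huv' : Quot.mk R' u = Quot.mk R' v := Quot.sound (Or.inl (Or.inr ⟨rfl, rfl⟩))
  -- The class of `v` is merged into that of `u`, so the new classes are the old ones other than the
  -- class of `v`.
  let f : V → {q : Quot R // q ≠ Quot.mk R v} := fun x =>
    if hx : Quot.mk R x = Quot.mk R v then ⟨Quot.mk R u, h⟩ else ⟨Quot.mk R x, hx⟩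
  have hf : ∀ a b, R' a b → f a = f b := by
    rintro a b ((hab | ⟨rfl, rfl⟩) | ⟨rfl, rfl⟩)
    · have := Quot.sound hab
      simp only [f, this]
    · simp [f, h]
    · simp [f, h]
  let E : Quot R' ≃ {q : Quot R // q ≠ Quot.mk R v} :=
    { toFun := Quot.lift f hf
      invFun := fun q => Quot.lift (Quot.mk R') (fun a b hab => Quot.sound (hR a b hab)) q.1
      left_inv := by
        rintro ⟨x⟩
        by_cases hx : Quot.mk R x = Quot.mk R v
        · simp only [f, hx, dif_pos]
          refine huv'.trans ?_
          exact (congrArg (Quot.lift (Quot.mk R') (fun a b hab => Quot.sound (hR a b hab))) hx).symm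
        · simp only [f, hx, dif_neg, not_false_eq_true]
      right_inv := by
        rintro ⟨⟨x⟩, hx⟩
        exact dif_neg hx }
  have : Fintype (Quot R) := Fintype.ofFinite _
  have hpos : 0 < Nat.card (Quot R) := Nat.card_pos_iff.2 ⟨⟨Quot.mk R u⟩, inferInstance⟩
  rw [Nat.card_congr E, Nat.card_eq_fintype_card, Fintype.card_subtype_compl,
    Fintype.card_subtype_eq, ← Nat.card_eq_fintype_card]
  omega

end Relation

namespace Relation

/-! ### Counting balanced orientations -/

section Count

variable {V ι : Type*} (r : V → V → Prop) (s t : ι → V)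

/-- The relation `r` together with both arcs of every edge in `A`, where the edge `e` has the ends
`s e` and `t e`. -/
def addEdges (A : Set ι) (x y : V) : Prop :=
  r x y ∨ ∃ e ∈ A, (x = s e ∧ y = t e) ∨ (x = t e ∧ y = s e)

/-- The relation `r` together with one arc for every edge in `F`: the arc from `s e` to `t e` if
`e ∈ B`, and the reverse arc otherwise. -/
def addOriented (F B : Set ι) (x y : V) : Prop :=
  r x y ∨ ∃ e ∈ F, (e ∈ B ∧ x = s e ∧ y = t e) ∨ (e ∉ B ∧ x = t e ∧ y = s e)

theorem addEdges_insert (e : ι) (A : Set ι) :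
    addEdges r s t (insert e A) = addEdges (addArc (addArc r (s e) (t e)) (t e) (s e)) s t A := by
  ext x y
  simp only [addEdges, addArc, Set.exists_mem_insert, or_assoc]

theorem addEdges_addArc_addArc (a b : V) (A : Set ι) :
    addEdges (addArc (addArc r a b) b a) s t A =
      addArc (addArc (addEdges r s t A) a b) b a := by
  ext x y
  simp only [addEdges, addArc]
  exact iff_of_eq (by ac_rfl)

theorem addOriented_addArc_addArc (a b : V) (F B : Set ι) :
    addOriented (addArc (addArc r a b) b a) s t F B =
      addArc (addArc (addOriented r s t F B) a b) b a := by
  ext x y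
  simp only [addOriented, addArc]
  exact iff_of_eq (by ac_rfl)

theorem addOriented_insert_of_notMem {e : ι} {F B : Set ι} (he : e ∉ B) :
    addOriented r s t (insert e F) B = addArc (addOriented r s t F B) (t e) (s e) := by
  ext x y
  simp only [addOriented, addArc, Set.exists_mem_insert, he, false_and, false_or,
    not_false_eq_true, true_and]
  exact iff_of_eq (by ac_rfl)

theorem addOriented_insert_insert {e : ι} {F B : Set ι} (he : e ∉ F) :
    addOriented r s t (insert e F) (insert e B) =
      addArc (addOriented r s t F B) (s e) (t e) := by
  ext x y
  have h : ∀ f ∈ F, (f ∈ insert e B ↔ f ∈ B) := fun f hf =>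
    Set.mem_insert_iff.trans (or_iff_right fun h => he (h ▸ hf))
  have h' : (∃ f ∈ F, (f ∈ insert e B ∧ x = s f ∧ y = t f) ∨
      (f ∉ insert e B ∧ x = t f ∧ y = s f)) ↔
      ∃ f ∈ F, (f ∈ B ∧ x = s f ∧ y = t f) ∨ (f ∉ B ∧ x = t f ∧ y = s f) :=
    exists_congr fun f => and_congr_right fun hf => by rw [h f hf]
  simp only [addOriented, addArc, Set.exists_mem_insert, h', Set.mem_insert, not_true_eq_false,
    false_and, or_false, true_and]
  exact iff_of_eq (by ac_rfl)

/-- Connectivity ignores directions, so whether an edge is a bridge is decided once for all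
orientations `B`. -/
theorem eqvGen_addOriented_iff (F B : Set ι) (a b : V) :
    EqvGen (addOriented r s t F B) a b ↔ EqvGen (addEdges r s t F) a b := by
  constructor
  · refine EqvGen.mono (α := V) ?_ a b
    rintro x y (h | ⟨e, he, h⟩)
    exacts [Or.inl h, Or.inr ⟨e, he, h.imp And.right And.right⟩]
  · intro h
    induction h with
    | rel x y h =>
      rcases h with h | ⟨e, he, ⟨rfl, rfl⟩ | ⟨rfl, rfl⟩⟩
      · exact .rel _ _ (Or.inl h)
      all_goals
        by_cases hB : e ∈ B
        · first
          | exact .rel _ _ (Or.inr ⟨e, he, Or.inl ⟨hB, rfl, rfl⟩⟩)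
          | exact .symm _ _ (.rel _ _ (Or.inr ⟨e, he, Or.inl ⟨hB, rfl, rfl⟩⟩))
        · first
          | exact .rel _ _ (Or.inr ⟨e, he, Or.inr ⟨hB, rfl, rfl⟩⟩)
          | exact .symm _ _ (.rel _ _ (Or.inr ⟨e, he, Or.inr ⟨hB, rfl, rfl⟩⟩))
    | refl x => exact .refl x
    | symm x y _ ih => exact .symm _ _ ih
    | trans x y z _ _ ih₁ ih₂ => exact .trans _ _ _ ih₁ ih₂

open Classical in
/-- The number of balanced orientations of the edges in `F` as an alternating sum over the
subsets of `F`. -/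
theorem sum_isBalanced_addOriented [Finite V] (F : Finset ι) (r : V → V → Prop)
    (hr : ∀ x y, r x y → r y x) :
    (∑ B ∈ F.powerset, if IsBalanced (addOriented r s t F B) then (1 : ℤ) else 0) =
      (-1) ^ Nat.card (Quot (addEdges r s t F)) *
        ∑ A ∈ F.powerset, (-1) ^ Nat.card (Quot (addEdges r s t A)) := by
  induction F using Finset.induction_on generalizing r with
  | empty =>
    have h : addOriented r s t ∅ ∅ = r := by
      ext x y
      simp [addOriented]
    rw [Finset.powerset_empty, Finset.sum_singleton, Finset.sum_singleton, Finset.coe_empty, h,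
      if_pos (isBalanced_of_symmetric hr), ← pow_add, ← two_mul, pow_mul, neg_one_sq, one_pow]
  | insert e F he ih =>
    -- Contraction of `e`: the background relation, over which the induction is generalised, absorbs
    -- both arcs and stays symmetric.
    set r' := addArc (addArc r (s e) (t e)) (t e) (s e) with hr'
    have hr'symm : ∀ x y, r' x y → r' y x := by
      rintro x y ((h | ⟨rfl, rfl⟩) | ⟨rfl, rfl⟩)
      exacts [Or.inl (Or.inl (hr x y h)), Or.inr ⟨rfl, rfl⟩, Or.inl (Or.inr ⟨rfl, rfl⟩)]
    have hL : (∑ B ∈ (insert e F).powerset,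
        if IsBalanced (addOriented r s t (insert e F : Finset ι) B) then (1 : ℤ) else 0) =
        ∑ B ∈ F.powerset,
          ((if IsBalanced (addArc (addOriented r s t F B) (t e) (s e)) then 1 else 0) +
            if IsBalanced (addArc (addOriented r s t F B) (s e) (t e)) then 1 else 0) := by
      rw [Finset.sum_powerset_insert he, ← Finset.sum_add_distrib]
      refine Finset.sum_congr rfl fun B hB => ?_
      have heB : e ∉ (B : Set ι) := fun h => he (Finset.mem_powerset.1 hB h)
      rw [Finset.coe_insert, Finset.coe_insert, addOriented_insert_of_notMem r s t heB,
        addOriented_insert_insert r s t (by simpa using he)]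
    have hR : ∑ A ∈ (insert e F).powerset, (-1 : ℤ) ^ Nat.card (Quot (addEdges r s t A)) =
        ∑ A ∈ F.powerset, (-1) ^ Nat.card (Quot (addEdges r s t A)) +
          ∑ A ∈ F.powerset, (-1) ^ Nat.card (Quot (addEdges r' s t A)) := by
      rw [Finset.sum_powerset_insert he]
      simp only [Finset.coe_insert, addEdges_insert, hr']
    rw [hL, hR, Finset.coe_insert, addEdges_insert, ← hr', mul_add, ← ih r' hr'symm]
    simp only [hr', addOriented_addArc_addArc]
    -- The sign in front belongs to `r'`; passing to the sign for `r` costs a factor -1 exactly when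
    -- `e` is a bridge.
    by_cases huv : EqvGen (addEdges r s t F) (s e) (t e)
    · rw [addEdges_addArc_addArc, card_quot_addArc_of_eqvGen huv, ← ih r hr,
        ← Finset.sum_add_distrib]
      refine Finset.sum_congr rfl fun B _ => ?_
      exact isBalanced_addArc_add_of_eqvGen ((eqvGen_addOriented_iff r s t F B _ _).2 huv)
    · have hsign : (-1 : ℤ) ^ Nat.card (Quot (addEdges r' s t F)) =
          -(-1) ^ Nat.card (Quot (addEdges r s t F)) := by
        rw [hr', addEdges_addArc_addArc, ← card_quot_addArc_of_not_eqvGen huv, pow_succ]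
        ring
      rw [← hr', hsign, neg_mul, ← ih r hr, ← Finset.sum_neg_distrib, ← Finset.sum_add_distrib]
      refine Finset.sum_congr rfl fun B _ => ?_
      exact isBalanced_addArc_add_of_not_eqvGen
        (mt (eqvGen_addOriented_iff r s t F B _ _).1 huv)

end Count

/-! ### Simple paths -/

/-- A path from `a` to `b` of least length has no repeated vertices. -/
theorem ReflTransGen.exists_injOn {V : Type*} {R : V → V → Prop} {a b : V}
    (h : ReflTransGen R a b) : ∃ (n : ℕ) (p : ℕ → V), p 0 = a ∧ p n = b ∧
      (∀ i < n, R (p i) (p (i + 1))) ∧ Set.InjOn p (Set.Iic n) := by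
  classical
  have hex : ∃ (n : ℕ) (p : ℕ → V), p 0 = a ∧ p n = b ∧ ∀ i < n, R (p i) (p (i + 1)) := by
    induction h with
    | refl => exact ⟨0, fun _ => a, rfl, rfl, by simp⟩
    | tail _ hbc ih =>
      rename_i b c _
      obtain ⟨n, p, h0, hn, hp⟩ := ih
      refine ⟨n + 1, fun i => if i ≤ n then p i else c, by simp [h0], by simp, fun i hi => ?_⟩
      rcases Nat.lt_succ_iff_lt_or_eq.1 hi with hi | rfl
      · simpa [hi.le, Nat.succ_le_of_lt hi] using hp i hi
      · simpa [hn] using hbc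
  obtain ⟨p, h0, hn, hp⟩ := Nat.find_spec hex
  have hmin := fun m => Nat.find_min hex (m := m)
  set n := Nat.find hex
  refine ⟨n, p, h0, hn, hp, ?_⟩
  have key : ∀ i j, i < j → j ≤ n → p i ≠ p j := by
    intro i j hij hj hpij
    -- A repetition `p i = p j` allows the stretch between `i` and `j` to be cut out, contradicting
    -- minimality.
    refine hmin (n - (j - i)) (by omega)
      ⟨fun m => if m ≤ i then p m else p (m + (j - i)), by simp [h0], ?_, fun m hm => ?_⟩
    · by_cases hjn : j = n
      · have : n - (j - i) = i := by omega
        simp only [this, le_refl, if_true]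
        rw [hpij, hjn, hn]
      · beta_reduce
        rw [if_neg (by omega), show n - (j - i) + (j - i) = n by omega, hn]
    · rcases lt_trichotomy m i with h | rfl | h
      · simpa [h.le, Nat.succ_le_of_lt h] using hp m (by omega)
      · simp only [le_refl, if_true, hpij, show ¬ m + 1 ≤ m by omega, if_false]
        rw [show m + 1 + (j - m) = j + 1 by omega]
        exact hp j (by omega)
      · simp only [show ¬ m ≤ i by omega, show ¬ m + 1 ≤ i by omega, if_false]
        rw [show m + 1 + (j - i) = m + (j - i) + 1 by omega]
        exact hp _ (by omega)
  intro i hi j hj hpij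
  by_contra hne
  rcases Nat.lt_or_gt_of_ne hne with h | h
  · exact key i j h hj hpij
  · exact key j i h hi hpij.symm

end Relation

namespace Graph

variable {α β : Type*} (G : Graph α β)

/-! ### Totally cyclic orientations are balanced orientations -/

/-- The first end of an edge, as an element of the vertex set. -/
noncomputable def firstVertex (e : G.edgeSet) : G.vertexSet :=
  ⟨G.firstEnd e, (G.isLink_firstEnd_secondEnd e).left_mem⟩

/-- The second end of an edge, as an element of the vertex set. -/
noncomputable def secondVertex (e : G.edgeSet) : G.vertexSet :=
  ⟨G.secondEnd e, (G.isLink_firstEnd_secondEnd e).right_mem⟩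

/-- The arcs of the orientation of `G` in which the edges in `B` keep their reference direction
and the other edges are reversed. -/
def arcs (B : Set G.edgeSet) : G.vertexSet → G.vertexSet → Prop :=
  Relation.addOriented (fun _ _ => False) G.firstVertex G.secondVertex Set.univ B

/-- Adjacency by an edge in `A`. -/
def adjBy (A : Set G.edgeSet) : G.vertexSet → G.vertexSet → Prop :=
  Relation.addEdges (fun _ _ => False) G.firstVertex G.secondVertex A

variable {G}

theorem arcs_iff (σ : G.Orientation) (x y : G.vertexSet) :
    G.arcs {e | σ e = true} x y ↔ ∃ e, (x : α) = σ.tail e ∧ (y : α) = σ.head e := by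
  simp only [arcs, Relation.addOriented, false_or, Set.mem_univ, true_and]
  refine exists_congr fun e => ?_
  cases h : σ e <;>
    simp [Orientation.tail, Orientation.head, h, firstVertex, secondVertex, Subtype.ext_iff]

theorem Orientation.tail_mem (σ : G.Orientation) (e : G.edgeSet) : σ.tail e ∈ G.vertexSet := by
  unfold Orientation.tail
  split_ifs
  exacts [(G.firstVertex e).2, (G.secondVertex e).2]

theorem Orientation.head_mem (σ : G.Orientation) (e : G.edgeSet) : σ.head e ∈ G.vertexSet := by
  unfold Orientation.head
  split_ifs
  exacts [(G.secondVertex e).2, (G.firstVertex e).2]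

/-- Following a cycle from the head of an arc back to its tail carries membership in a forward
closed set along. Conversely, the set reachable from the head of `e` is forward closed, so it
contains the tail of `e`, and a simple path closed up by `e` is a directed cycle. -/
theorem Orientation.isTotallyCyclic_iff (σ : G.Orientation) :
    σ.IsTotallyCyclic ↔ Relation.IsBalanced (G.arcs {e | σ e = true}) := by
  constructor
  · intro h S hS x y hxy hy
    obtain ⟨e, hx, hy'⟩ := (arcs_iff σ x y).1 hxy
    obtain ⟨k, c, ⟨hc, -⟩, i, rfl⟩ := h e
    let τ : Fin (k + 1) → G.vertexSet := fun j => ⟨σ.tail (c j), σ.tail_mem _⟩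
    have hstep : ∀ j, τ j ∈ S → τ (j + 1) ∈ S := fun j =>
      hS _ _ ((arcs_iff σ _ _).2 ⟨c j, rfl, (hc j).symm⟩)
    have hsteps : ∀ (m : ℕ) (j), τ j ∈ S → τ (j + m • 1) ∈ S := by
      intro m
      induction m with
      | zero => intro j hj; simpa using hj
      | succ m ih =>
        intro j hj
        have := hstep _ (ih j hj)
        rwa [add_assoc, ← succ_nsmul] at this
    have h₁ : y = τ (i + 1) := Subtype.ext (hy'.trans (hc i))
    have h₂ := hsteps k (i + 1) (h₁ ▸ hy)
    have h₃ : i + 1 + k • 1 = i := by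
      have := card_nsmul_eq_zero (x := (1 : Fin (k + 1)))
      rw [Fintype.card_fin] at this
      rw [add_assoc, ← succ_nsmul', this, add_zero]
    rw [h₃] at h₂
    rwa [show x = τ i from Subtype.ext hx]
  · intro h e
    let a : G.vertexSet := ⟨σ.head e, σ.head_mem e⟩
    let b : G.vertexSet := ⟨σ.tail e, σ.tail_mem e⟩
    have hab : Relation.ReflTransGen (G.arcs {e | σ e = true}) a b :=
      h {x | Relation.ReflTransGen (G.arcs {e | σ e = true}) a x}
        (fun x y hxy hx => hx.tail hxy) b a ((arcs_iff σ b a).2 ⟨e, rfl, rfl⟩) .refl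
    obtain ⟨n, p, h0, hn, hp, hinj⟩ := hab.exists_injOn
    have : Nonempty G.edgeSet := ⟨e⟩
    choose! q hq using fun i (hi : i < n) => (arcs_iff σ _ _).1 (hp i hi)
    -- The `n` arcs of the path, then `e` at the last index; for `n = 0` the edge `e` is a loop.
    let c : Fin (n + 1) → G.edgeSet := fun i => if i.1 < n then q i.1 else e
    have htail : ∀ i, σ.tail (c i) = p i := by
      intro i
      by_cases hi : i.1 < n
      · simp only [c, hi, if_true, (hq i.1 hi).1]
      · have : i.1 = n := by omega
        simp only [c, this, lt_irrefl, if_false, hn, b]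
    have hhead : ∀ i, σ.head (c i) = p (i + 1 : Fin (n + 1)) := by
      intro i
      rw [Fin.val_add_one]
      by_cases hi : i.1 < n
      · rw [if_neg (fun h => by simp [h] at hi)]
        simp only [c, hi, if_true, (hq i.1 hi).2]
      · have : i = Fin.last n := Fin.ext (by simp; omega)
        simp only [c, this, Fin.val_last, lt_irrefl, if_false, if_true, h0, a]
    refine ⟨n, c, ⟨fun i => (hhead i).trans (htail _).symm, fun i j hij => ?_⟩, Fin.last n,
      by simp [c]⟩
    simp only [htail] at hij
    exact Fin.ext (hinj (Nat.lt_succ_iff.1 i.2) (Nat.lt_succ_iff.1 j.2) (Subtype.ext hij))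

/-! ### The Tutte polynomial at `(0, 2)` -/

theorem numComponents_restrict (A : Set G.edgeSet) :
    (G.restrict (Subtype.val '' A)).numComponents = Nat.card (Quot (G.adjBy A)) := by
  refine Nat.card_congr (Quot.congrRight fun x y => ?_)
  simp only [adjBy, Relation.addEdges, false_or]
  constructor
  · rintro ⟨e, he⟩
    obtain ⟨⟨e, heA, rfl⟩, he⟩ := he
    refine ⟨e, heA, ?_⟩
    exact (he.eq_and_eq_or_eq_and_eq (G.isLink_firstEnd_secondEnd e)).imp
      (And.imp Subtype.ext Subtype.ext) (And.imp Subtype.ext Subtype.ext)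
  · rintro ⟨e, heA, h⟩
    refine ⟨e, ⟨e, heA, rfl⟩, ?_⟩
    rcases h with ⟨rfl, rfl⟩ | ⟨rfl, rfl⟩
    exacts [G.isLink_firstEnd_secondEnd e, (G.isLink_firstEnd_secondEnd e).symm]

theorem card_quot_adjBy_le [Finite G.vertexSet] (A : Set G.edgeSet) :
    Nat.card (Quot (G.adjBy A)) ≤ G.vertexSet.ncard :=
  Nat.card_le_card_of_surjective _ Quot.mk_surjective

theorem card_quot_adjBy_mono [Finite G.vertexSet] {A B : Set G.edgeSet} (h : A ⊆ B) :
    Nat.card (Quot (G.adjBy B)) ≤ Nat.card (Quot (G.adjBy A)) := by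
  refine Nat.card_le_card_of_surjective (Quot.map id ?_) ?_
  · rintro x y (hxy | ⟨e, he, hxy⟩)
    exacts [hxy.elim, Or.inr ⟨e, h he, hxy⟩]
  · rintro ⟨x⟩
    exact ⟨Quot.mk _ x, rfl⟩

theorem tuttePolynomial_zero_two [Finite G.vertexSet] [Fintype G.edgeSet] :
    G.tuttePolynomial (0 : ℤ) 2 = (-1) ^ Nat.card (Quot (G.adjBy Set.univ)) *
      ∑ A : Finset G.edgeSet, (-1) ^ Nat.card (Quot (G.adjBy A)) := by
  rw [tuttePolynomial, Finset.mul_sum, ← finsum_eq_sum_of_fintype]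
  refine Eq.symm ((finsum_mem_univ _).symm.trans (finsum_mem_eq_of_bijOn
    (fun A : Finset G.edgeSet => Subtype.val '' (A : Set G.edgeSet)) ?_ ?_))
  · refine ⟨fun A _ => ?_, fun A _ B _ h => ?_, fun A hA => ?_⟩
    · rintro _ ⟨e, -, rfl⟩
      exact e.2
    · exact Finset.coe_injective (Subtype.val_injective.image_injective h)
    · refine ⟨(Set.toFinite (Subtype.val ⁻¹' A : Set G.edgeSet)).toFinset, trivial, ?_⟩
      have hA' : A ⊆ G.edgeSet := hA
      simpa using hA'
  · intro A _
    have hE : G.edgeSet = Subtype.val '' (Set.univ : Set G.edgeSet) := by simp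
    have h₁ := card_quot_adjBy_le (A : Set G.edgeSet)
    have h₂ := card_quot_adjBy_mono (Set.subset_univ (A : Set G.edgeSet))
    have hr : G.edgeRank G.edgeSet = G.vertexSet.ncard - Nat.card (Quot (G.adjBy Set.univ)) := by
      rw [edgeRank, ← numComponents_restrict, ← hE]
    rw [hr, edgeRank, numComponents_restrict]
    -- `d` is c(A) - c(E), which equals r(E) - r(A) without truncation because c(A) ≤ |V|.
    obtain ⟨d, hd⟩ := Nat.exists_eq_add_of_le h₂
    rw [hd] at h₁ ⊢
    have hexp : ∀ v a : ℕ, a + d ≤ v → v - a - (v - (a + d)) = d := by omega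
    rw [hexp _ _ h₁, pow_add, ← mul_assoc, ← mul_pow]
    norm_num

theorem card_isTotallyCyclic [Finite G.vertexSet] [Fintype G.edgeSet] :
    (Nat.card {σ : G.Orientation // σ.IsTotallyCyclic} : ℤ) =
      (-1) ^ Nat.card (Quot (G.adjBy Set.univ)) *
        ∑ A : Finset G.edgeSet, (-1) ^ Nat.card (Quot (G.adjBy A)) := by
  classical
  have h := Relation.sum_isBalanced_addOriented G.firstVertex G.secondVertex Finset.univ
    (fun _ _ => False) (fun _ _ h => h)
  simp only [Finset.powerset_univ, Finset.coe_univ] at h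
  refine Eq.trans ?_ h
  let E : G.Orientation ≃ Finset G.edgeSet :=
    { toFun := fun σ => Finset.univ.filter fun e => σ e = true
      invFun := fun B e => decide (e ∈ B)
      left_inv := fun σ => by ext e; simp
      right_inv := fun B => by ext e; simp }
  have hE : ∀ σ : G.Orientation, σ.IsTotallyCyclic ↔ Relation.IsBalanced (G.arcs (E σ)) := by
    intro σ
    rw [σ.isTotallyCyclic_iff]
    simp [E]
  rw [Finset.sum_boole, Nat.card_congr (E.subtypeEquiv
    (q := fun B : Finset G.edgeSet => Relation.IsBalanced (G.arcs B)) hE),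
    Nat.card_eq_fintype_card, Fintype.card_subtype]
  rfl

end Graph

namespace Graph

variable {α β : Type*} {G : Graph α β}

/-! ### The chromatic polynomial of the hypergraph of a multigraph -/

/-- Colourings of the vertices of `G.edgeHypergraph` are pairs of colourings of the vertices and of
the edges of `G`. -/
noncomputable def colouringEquiv (G : Graph α β) (C : Type*) :
    (G.edgeHypergraph.vertexSet → C) ≃ (G.vertexSet → C) × (G.edgeSet → C) where
  toFun φ := (fun v => φ ⟨Sum.inl v.1, Or.inl ⟨v.1, v.2, rfl⟩⟩,
    fun e => φ ⟨Sum.inr e.1, Or.inr ⟨e.1, e.2, rfl⟩⟩)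
  invFun p x :=
    match x with
    | ⟨Sum.inl v, h⟩ => p.1 ⟨v, by simpa [edgeHypergraph] using h⟩
    | ⟨Sum.inr e, h⟩ => p.2 ⟨e, by simpa [edgeHypergraph] using h⟩
  left_inv φ := by
    funext x
    rcases x with ⟨v | e, h⟩ <;> rfl
  right_inv p := rfl

theorem isWeakProper_iff {n : ℕ} (φ : G.edgeHypergraph.vertexSet → Fin n) :
    G.edgeHypergraph.IsWeakProper φ ↔ ∀ e : G.edgeSet,
      (G.colouringEquiv _ φ).1 (G.firstVertex e) = (G.colouringEquiv _ φ).1 (G.secondVertex e) →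
        (G.colouringEquiv _ φ).2 e ≠ (G.colouringEquiv _ φ).1 (G.firstVertex e) := by
  set x : G.edgeSet → G.edgeHypergraph.vertexSet := fun e =>
    ⟨Sum.inl (G.firstVertex e).1, Or.inl ⟨_, (G.firstVertex e).2, rfl⟩⟩ with hx
  set y : G.edgeSet → G.edgeHypergraph.vertexSet := fun e =>
    ⟨Sum.inl (G.secondVertex e).1, Or.inl ⟨_, (G.secondVertex e).2, rfl⟩⟩ with hy
  set z : G.edgeSet → G.edgeHypergraph.vertexSet := fun e =>
    ⟨Sum.inr e.1, Or.inr ⟨e.1, e.2, rfl⟩⟩ with hz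
  have himage : ∀ e : G.edgeSet, φ '' {v | (v : α ⊕ β) ∈
      ({Sum.inl (G.firstEnd e), Sum.inl (G.secondEnd e), Sum.inr e.1} : Set (α ⊕ β))} =
      {φ (x e), φ (y e), φ (z e)} := by
    intro e
    have : {v : G.edgeHypergraph.vertexSet | (v : α ⊕ β) ∈
        ({Sum.inl (G.firstEnd e), Sum.inl (G.secondEnd e), Sum.inr e.1} : Set (α ⊕ β))} =
        {x e, y e, z e} := by
      ext v
      simp [hx, hy, hz, Subtype.ext_iff, firstVertex, secondVertex]
    rw [this, Set.image_insert_eq, Set.image_insert_eq, Set.image_singleton]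
  have hnt : ∀ a b c : Fin n, ({a, b, c} : Set (Fin n)).Nontrivial ↔ (a = b → c ≠ a) := by
    intro a b c
    constructor
    · rintro h rfl rfl
      simp at h
    · intro h
      by_cases hab : a = b
      · exact ⟨c, by simp, a, by simp, h hab⟩
      · exact ⟨a, by simp, b, by simp, hab⟩
  change _ ↔ ∀ e, φ (x e) = φ (y e) → φ (z e) ≠ φ (x e)
  constructor
  · intro h e
    rw [← hnt, ← himage]
    exact h _ ⟨e, _, _, G.isLink_firstEnd_secondEnd e, rfl⟩
  · rintro h _ ⟨e, u, v, he, rfl⟩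
    have hmem := he.edge_mem
    have := (hnt _ _ _).2 (h ⟨e, hmem⟩)
    rw [← himage] at this
    -- The listing `u`, `v` may be the reverse of the reference listing, which gives the same
    -- hyperedge.
    rcases he.eq_and_eq_or_eq_and_eq (G.isLink_firstEnd_secondEnd ⟨e, hmem⟩) with
      ⟨hu, hv⟩ | ⟨hu, hv⟩
    · rwa [hu, hv]
    · rwa [hu, hv, Set.insert_comm]

/-- Vertex colourings that are constant along the edges in `A` are colourings of the components. -/
def constantOnEdgesEquiv (A : Set G.edgeSet) (C : Type*) :
    {φ : G.vertexSet → C // ∀ e ∈ A, φ (G.firstVertex e) = φ (G.secondVertex e)} ≃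
      (Quot (G.adjBy A) → C) where
  toFun φ := Quot.lift φ.1 (by
    rintro x y (h | ⟨e, he, ⟨rfl, rfl⟩ | ⟨rfl, rfl⟩⟩)
    exacts [h.elim, φ.2 e he, (φ.2 e he).symm])
  invFun f := ⟨fun x => f (Quot.mk _ x), fun e he =>
    congrArg f (Quot.sound (Or.inr ⟨e, he, Or.inl ⟨rfl, rfl⟩⟩))⟩
  left_inv φ := rfl
  right_inv f := by
    ext ⟨x⟩
    rfl

-- Once `φ` is fixed, the colours of the new vertices are chosen independently. The factors are
-- written as sums, ready for expansion over edge subsets.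
open Classical in
theorem card_edgeColourings {n : ℕ} [Fintype G.edgeSet] (φ : G.vertexSet → Fin n) :
    (Nat.card {ψ : G.edgeSet → Fin n // ∀ e, φ (G.firstVertex e) = φ (G.secondVertex e) →
      ψ e ≠ φ (G.firstVertex e)} : ℤ) =
      ∏ e : G.edgeSet,
        ((if φ (G.firstVertex e) = φ (G.secondVertex e) then (-1 : ℤ) else 0) + n) := by
  rw [Nat.card_congr (Equiv.subtypePiEquivPi (p := fun e c =>
    φ (G.firstVertex e) = φ (G.secondVertex e) → c ≠ φ (G.firstVertex e))), Nat.card_pi,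
    Nat.cast_prod]
  refine Finset.prod_congr rfl fun e _ => ?_
  rw [Nat.card_eq_fintype_card]
  split_ifs with h
  · simp only [h, true_imp_iff]
    have hn : 1 ≤ n := (Nat.zero_le _).trans_lt (φ (G.firstVertex e)).2
    rw [Fintype.card_subtype_compl, Fintype.card_subtype_eq, Fintype.card_fin, Nat.cast_sub hn]
    push_cast
    ring
  · simp [h]

open Polynomial in
theorem chromaticPolynomial_edgeHypergraph [Finite G.vertexSet] [Fintype G.edgeSet] :
    G.edgeHypergraph.chromaticPolynomial = ∑ A : Finset G.edgeSet,
      (-1) ^ A.card * X ^ (Fintype.card G.edgeSet - A.card + Nat.card (Quot (G.adjBy A))) := by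
  classical
  have : Fintype G.vertexSet := Fintype.ofFinite _
  refine Hypergraph.countsColourings_unique _
    (Hypergraph.chromaticPolynomial_countsColourings _
      (((Set.toFinite _).image _).union ((Set.toFinite _).image _))) ?_
  intro n _
  have h : (G.edgeHypergraph.numWeakColourings n : ℤ) = ∑ φ : G.vertexSet → Fin n,
      ∏ e : G.edgeSet,
        ((if φ (G.firstVertex e) = φ (G.secondVertex e) then (-1 : ℤ) else 0) + n) := by
    rw [Hypergraph.numWeakColourings, Nat.card_congr (((G.colouringEquiv (Fin n)).subtypeEquiv
      (q := fun p => ∀ e : G.edgeSet, p.1 (G.firstVertex e) = p.1 (G.secondVertex e) →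
        p.2 e ≠ p.1 (G.firstVertex e)) isWeakProper_iff).trans
      (Equiv.subtypeProdEquivSigmaSubtype
        fun (φ : G.vertexSet → Fin n) (ψ : G.edgeSet → Fin n) => ∀ e : G.edgeSet,
        φ (G.firstVertex e) = φ (G.secondVertex e) → ψ e ≠ φ (G.firstVertex e))),
      Nat.card_sigma, Nat.cast_sum]
    exact Finset.sum_congr rfl fun φ _ => card_edgeColourings φ
  rw [h]
  -- `A` is the set of edges from which the term -1 or 0 is taken; only colourings constant along
  -- all edges of `A` survive, and there are n^c(A) of them.
  simp only [Fintype.prod_add]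
  rw [Finset.sum_comm, eval_finsetSum]
  refine Finset.sum_congr rfl fun A _ => ?_
  have hA : ∀ φ : G.vertexSet → Fin n,
      (∏ e ∈ A, if φ (G.firstVertex e) = φ (G.secondVertex e) then (-1 : ℤ) else 0) =
        (-1) ^ A.card * if ∀ e ∈ (A : Set G.edgeSet),
          φ (G.firstVertex e) = φ (G.secondVertex e) then 1 else 0 := by
    intro φ
    split_ifs with hφ
    · rw [Finset.prod_congr rfl fun e he => if_pos (hφ e he), Finset.prod_const, mul_one]
    · push Not at hφ
      obtain ⟨e, he, hne⟩ := hφ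
      rw [Finset.prod_eq_zero (i := e) he (if_neg hne), mul_zero]
  simp only [hA, Finset.prod_const, Finset.card_compl]
  have hc := Nat.card_congr (constantOnEdgesEquiv (A : Set G.edgeSet) (Fin n))
  rw [Nat.card_fun, Nat.card_fin, Nat.card_eq_fintype_card] at hc
  rw [← Finset.sum_mul, ← Finset.mul_sum, Finset.sum_boole, ← Fintype.card_subtype, hc]
  simp only [eval_mul, eval_pow, eval_neg, eval_one, eval_X, ← Nat.card_eq_fintype_card]
  push_cast
  ring

theorem eval_neg_one_chromaticPolynomial [Finite G.vertexSet] [Fintype G.edgeSet] :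
    G.edgeHypergraph.chromaticPolynomial.eval (-1) = (-1) ^ Fintype.card G.edgeSet *
      ∑ A : Finset G.edgeSet, (-1) ^ Nat.card (Quot (G.adjBy A)) := by
  rw [chromaticPolynomial_edgeHypergraph, Polynomial.eval_finsetSum, Finset.mul_sum]
  refine Finset.sum_congr rfl fun A _ => ?_
  simp only [Polynomial.eval_mul, Polynomial.eval_pow, Polynomial.eval_neg, Polynomial.eval_one,
    Polynomial.eval_X]
  -- The exponents |A| and |E| - |A| add up to |E|, so this sign does not depend on `A`.
  rw [pow_add, ← mul_assoc, ← pow_add, Nat.add_sub_cancel' (Finset.card_le_univ A)]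

end Graph

theorem mainTheorem4 {α β : Type*} (G : Graph α β)
    (hV : G.vertexSet.Finite) (hE : G.edgeSet.Finite) :
    |G.edgeHypergraph.chromaticPolynomial.eval (-1)| = G.tuttePolynomial (0 : ℤ) 2 ∧
      G.tuttePolynomial (0 : ℤ) 2 = (Nat.card {σ : G.Orientation // σ.IsTotallyCyclic} : ℤ) := by
  have : Finite G.vertexSet := hV
  have : Fintype G.edgeSet := hE.fintype
  have h : G.tuttePolynomial (0 : ℤ) 2 = Nat.card {σ : G.Orientation // σ.IsTotallyCyclic} :=
    Graph.tuttePolynomial_zero_two.trans Graph.card_isTotallyCyclic.symm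
  refine ⟨?_, h⟩
  have h₀ : 0 ≤ G.tuttePolynomial (0 : ℤ) 2 := h ▸ Int.natCast_nonneg _
  -- With absolute values on both sides, only the unit factors (-1)^|E| and (-1)^c(E) distinguish
  -- them.
  rw [← abs_of_nonneg h₀, Graph.tuttePolynomial_zero_two, Graph.eval_neg_one_chromaticPolynomial]
  simp [abs_mul]
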